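/- There exist a computable map $f:[0,1]\to[0,1]$ and a set $\mathcal A\subseteq[0,1]$ such that $\mathcal A$ is a metric attractor of $f$ with respect to Lebesgue measure $\lambda$, and $\mathcal A$ is $\Pi_2$-complete; moreover the outer collection of $\mathcal A$ is a $\Sigma_2$-complete set of integers under many-one reductions. Here the following terms are used. A computable metric space is a metric space $(X,d)$ with a dense sequence $(s_i)_{i\in\mathbb N}$ of ideal points such that some algorithm, on input $(i,j,n)$, outputs a rational within $2^{-n}$ of $d(s_i,s_j)$. Its ideal balls $B_0,B_1,\dots$ are the open balls with centre an ideal point and positive rational radius, in a fixed computable enumeration, and $\overline{B_i}$ denotes the closed ball with the same centre and radius as $B_i$. The interval $[0,1]$ carries its usual metric and the ideal points $\mathbb Q\cap[0,1]$, enumerated computably. A map $T:X\to X'$ between computable metric spaces is computable if there is an algorithm that, on input $m$, enumerates a set $I_m\subseteq\mathbb N$ with $T^{-1}(B'_m)=\bigcup_{i\in I_m}B_i$. For $f:[0,1]\to[0,1]$ let $\omega(x)$ be the set of accumulation points of the sequence $x,f(x),f^2(x),\dots$, and for $A\subseteq[0,1]$ let $\rho(A)=\{x:\omega(x)\subseteq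 A\}$. A closed set $A$ with $f(A)\subseteq A$ is a metric attractor of $f$ if $\rho(A)$ has full Lebesgue measure and there is no closed $A'\subsetneq A$ for which $\rho(A')$ has positive measure. A set $S\subseteq\mathbb N$ is $\Sigma_2$ if there is a computable relation $R$ with $i\in S\iff\exists a\,\forall b\;R(i,a,b)$; it is $\Sigma_2$-complete under many-one reductions if in addition every $\Sigma_2$ set of integers is many-one reducible to it. The outer collection of a set $K\subseteq X$ is $\{i\in\mathbb N:\overline{B_i}\cap K=\emptyset\}$, and $K$ is $\Pi_2$ if its outer collection is a $\Sigma_2$ set. A closed set $K$ is $\Pi_2$-complete if it is $\Pi_2$ and, for every $\Pi_2$ closed subset $K'$ of any computable metric space, there is an algorithm (an enumeration operator) that, provided with any enumeration of the outer collection of $K$, enumerates the outer collection of $K'$. -/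

import Mathlib

/-! ### Dynamics: limit sets and metric attractors -/

/-- `limitSet T x` is the set `ω(x)` of accumulation points of the sequence
`x, T x, T (T x), …`. -/
def limitSet {X : Type*} [TopologicalSpace X] (T : X → X) (x : X) : Set X :=
  {y | MapClusterPt y Filter.atTop (fun n : ℕ => T^[n] x)}

/-- The realm of attraction `ρ(A) = {x : ω(x) ⊆ A}`. -/
def realm {X : Type*} [TopologicalSpace X] (T : X → X) (A : Set X) : Set X :=
  {x | limitSet T x ⊆ A}

/-- `A` is a metric attractor of `T` with respect to the reference measure `μ`: a closed
invariant set whose realm of attraction has full measure, and such that no strictly smaller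
closed subset has a realm of attraction of positive (outer) measure. -/
structure IsMetricAttractor {X : Type*} [TopologicalSpace X] [MeasurableSpace X]
    (μ : MeasureTheory.Measure X) (T : X → X) (A : Set X) : Prop where
  isClosed : IsClosed A
  invariant : Set.MapsTo T A A
  full : μ (realm T A)ᶜ = 0
  minimal : ∀ A' : Set X, IsClosed A' → A' ⊂ A → μ (realm T A') = 0

/-! ### Computable metric spaces -/

/-- A numbering of the rationals: the code of `(a - b) / (c + 1)` is `⟨⟨a, b⟩, c⟩`.
Every rational number has a code, and numerator and denominator are computable from it. -/
def ratOfNat (n : ℕ) : ℚ :=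
  (((n.unpair.1.unpair.1 : ℕ) : ℚ) - ((n.unpair.1.unpair.2 : ℕ) : ℚ)) /
    (((n.unpair.2 : ℕ) : ℚ) + 1)

/-- A numbering of the positive rationals: the code of `(a + 1) / (b + 1)` is `⟨a, b⟩`. -/
def posRatOfNat (n : ℕ) : ℚ :=
  (((n.unpair.1 : ℕ) : ℚ) + 1) / (((n.unpair.2 : ℕ) : ℚ) + 1)

/-- A computable metric space: a metric space with a dense sequence of ideal points whose
mutual distances are uniformly computable. -/
class ComputableMetricSpace (X : Type*) [MetricSpace X] where
  /-- the ideal points -/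
  point : ℕ → X
  dense_point : DenseRange point
  /-- An algorithm maps `(i, j, n)` to (the code of) a rational number at distance at most
  `2⁻ⁿ` from the distance of the `i`-th and the `j`-th ideal point. -/
  dist_computable : ∃ q : ℕ × ℕ × ℕ → ℕ, Computable q ∧
    ∀ i j n : ℕ, |dist (point i) (point j) - ((ratOfNat (q (i, j, n)) : ℚ) : ℝ)| ≤ 1 / 2 ^ n

section
variable (X : Type*) [MetricSpace X] [ComputableMetricSpace X]

/-- The enumeration `B₀, B₁, …` of the ideal balls (open balls of positive rational radius
around ideal points): the ball with number `⟨i, k⟩` has centre the `i`-th ideal point and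
radius the `k`-th positive rational. -/
def idealBall (n : ℕ) : Set X :=
  Metric.ball (ComputableMetricSpace.point n.unpair.1) ((posRatOfNat n.unpair.2 : ℚ) : ℝ)

/-- The closed ideal ball with the same centre and radius as `idealBall X n`. -/
def closedIdealBall (n : ℕ) : Set X :=
  Metric.closedBall (ComputableMetricSpace.point n.unpair.1)
    ((posRatOfNat n.unpair.2 : ℚ) : ℝ)

end

/-- A map between computable metric spaces is computable if the preimage of the `m`-th ideal
ball is the union of a family of ideal balls that is recursively enumerable uniformly
in `m`. -/
def IsComputableMap {X Y : Type*} [MetricSpace X] [ComputableMetricSpace X]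
    [MetricSpace Y] [ComputableMetricSpace Y] (T : X → Y) : Prop :=
  ∃ W : ℕ × ℕ → Prop, REPred W ∧
    ∀ m : ℕ, T ⁻¹' (idealBall Y m) = ⋃ i ∈ {i : ℕ | W (m, i)}, idealBall X i

/-! ### Complexity of closed sets -/

/-- `S ⊆ ℕ` is a `Σ₂` set: `i ∈ S ↔ ∃ a, ∀ b, R (i, a, b)` with `R` computable. -/
def IsSigmaTwo (S : Set ℕ) : Prop :=
  ∃ R : ℕ × ℕ × ℕ → Bool, Computable R ∧ ∀ i : ℕ, i ∈ S ↔ ∃ a : ℕ, ∀ b : ℕ, R (i, a, b) = true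

/-- The outer collection of `K`: the (numbers of the) ideal balls whose closed ball is disjoint
from `K`. -/
def outerCollection {X : Type*} [MetricSpace X] [ComputableMetricSpace X] (K : Set X) : Set ℕ :=
  {i | Disjoint (closedIdealBall X i) K}

/-- A set `K` is `Π₂` if its outer collection is a `Σ₂` set of integers. -/
def IsPiTwo {X : Type*} [MetricSpace X] [ComputableMetricSpace X] (K : Set X) : Prop :=
  IsSigmaTwo (outerCollection K)

/-- `EnumReducible A B`: there is an algorithm (an enumeration operator) that, provided with
any enumeration of `B`, enumerates `A`. The recursively enumerable `W` is the list of its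
rules `(n, D)`: "once all elements of `D` have been enumerated in `B`, enumerate `n`". -/
def EnumReducible (A B : Set ℕ) : Prop :=
  ∃ W : ℕ × List ℕ → Prop, REPred W ∧
    ∀ n : ℕ, n ∈ A ↔ ∃ D : List ℕ, W (n, D) ∧ ∀ d ∈ D, d ∈ B

/-- A closed set `K` is `Π₂`-complete if it is `Π₂` and, for every `Π₂` closed set `K'` of any
computable metric space, an enumeration of the outer collection of `K` can be turned
into one of the outer collection of `K'`. -/
def IsPiTwoComplete {X : Type*} [MetricSpace X] [ComputableMetricSpace X] (K : Set X) : Prop :=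
  IsClosed K ∧ IsPiTwo K ∧
    ∀ (Y : Type) [MetricSpace Y] [ComputableMetricSpace Y] (K' : Set Y),
      IsClosed K' → IsPiTwo K' → EnumReducible (outerCollection K') (outerCollection K)

/-- `B ⊆ ℕ` is `Σ₂`-complete in the usual sense of the arithmetical hierarchy: it is `Σ₂` and
every `Σ₂` set of integers is many-one reducible to it. -/
def IsSigmaTwoCompleteSet (B : Set ℕ) : Prop :=
  IsSigmaTwo B ∧ ∀ S : Set ℕ, IsSigmaTwo S → ManyOneReducible (fun n => n ∈ S) (fun n => n ∈ B)

/-! ### The unit interval as a computable metric space -/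

/-- The enumeration `⟨a, b⟩ ↦ min a (b + 1) / (b + 1)` of the rationals in `[0, 1]`. -/
noncomputable def unitPoint (n : ℕ) : unitInterval :=
  ⟨((min n.unpair.1 (n.unpair.2 + 1) : ℕ) : ℝ) / (((n.unpair.2 + 1 : ℕ)) : ℝ), by
    constructor
    · positivity
    · rw [div_le_one (by positivity)]
      exact_mod_cast min_le_right _ _⟩

theorem exists_unitPoint_eq (q : ℚ) (h0 : 0 ≤ q) (h1 : q ≤ 1) :
    ∃ n : ℕ, ((unitPoint n : unitInterval) : ℝ) = (q : ℝ) := by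
  obtain ⟨a, ha⟩ := Int.eq_ofNat_of_zero_le (Rat.num_nonneg.2 h0)
  have hd : q.den - 1 + 1 = q.den := Nat.sub_add_cancel q.den_pos
  have hq : (q : ℝ) = (a : ℝ) / (q.den : ℝ) := by
    rw [Rat.cast_def, ha]; simp
  have hle : a ≤ q.den := by
    have h2 : (q : ℝ) ≤ 1 := by exact_mod_cast h1
    rw [hq, div_le_one (by exact_mod_cast q.den_pos)] at h2
    exact_mod_cast h2
  refine ⟨Nat.pair a (q.den - 1), ?_⟩
  simp only [unitPoint, Nat.unpair_pair, hd, min_eq_left hle, hq]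

theorem denseRange_unitPoint : DenseRange unitPoint := by
  intro x
  rw [Metric.mem_closure_range_iff]
  intro ε hε
  by_cases hx : (x : ℝ) = 0
  · obtain ⟨n, hn⟩ := exists_unitPoint_eq 0 le_rfl zero_le_one
    refine ⟨n, ?_⟩
    rw [Subtype.dist_eq, hn, hx]
    simpa using hε
  · have hx0 : (0 : ℝ) < x := lt_of_le_of_ne x.2.1 (Ne.symm hx)
    obtain ⟨q, hq1, hq2⟩ := exists_rat_btwn (max_lt hx0 (sub_lt_self (x : ℝ) hε))
    have hq0 : (0 : ℝ) < q := lt_of_le_of_lt (le_max_left _ _) hq1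
    have hqε : (x : ℝ) - ε < q := lt_of_le_of_lt (le_max_right _ _) hq1
    have hqx : (q : ℝ) ≤ 1 := hq2.le.trans x.2.2
    obtain ⟨n, hn⟩ := exists_unitPoint_eq q (by exact_mod_cast hq0.le) (by exact_mod_cast hqx)
    refine ⟨n, ?_⟩
    rw [Subtype.dist_eq, hn, Real.dist_eq, abs_lt]
    constructor <;> linarith

/-- Code of the exact distance of two rationals in `[0, 1]`. -/
def unitDistCode (p : ℕ × ℕ × ℕ) : ℕ :=
  let a := min p.1.unpair.1 (p.1.unpair.2 + 1) * (p.2.1.unpair.2 + 1)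
  let b := min p.2.1.unpair.1 (p.2.1.unpair.2 + 1) * (p.1.unpair.2 + 1)
  Nat.pair (Nat.pair ((a - b) + (b - a)) 0)
    ((p.1.unpair.2 + 1) * (p.2.1.unpair.2 + 1) - 1)

theorem computable_unitDistCode : Computable unitDistCode := by
  have h1 : Primrec (fun p : ℕ × ℕ × ℕ => p.1.unpair.1) :=
    Primrec.fst.comp (Primrec.unpair.comp Primrec.fst)
  have h2 : Primrec (fun p : ℕ × ℕ × ℕ => p.1.unpair.2 + 1) :=
    Primrec.succ.comp (Primrec.snd.comp (Primrec.unpair.comp Primrec.fst))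
  have h3 : Primrec (fun p : ℕ × ℕ × ℕ => p.2.1.unpair.1) :=
    Primrec.fst.comp (Primrec.unpair.comp (Primrec.fst.comp Primrec.snd))
  have h4 : Primrec (fun p : ℕ × ℕ × ℕ => p.2.1.unpair.2 + 1) :=
    Primrec.succ.comp (Primrec.snd.comp (Primrec.unpair.comp (Primrec.fst.comp Primrec.snd)))
  have ha := Primrec.nat_mul.comp (Primrec.nat_min.comp h1 h2) h4
  have hb := Primrec.nat_mul.comp (Primrec.nat_min.comp h3 h4) h2
  have hn := Primrec.nat_add.comp (Primrec.nat_sub.comp ha hb) (Primrec.nat_sub.comp hb ha)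
  have hd := Primrec.nat_sub.comp (Primrec.nat_mul.comp h2 h4) (Primrec.const 1)
  exact (Primrec₂.natPair.comp (Primrec₂.natPair.comp hn (Primrec.const 0)) hd).to_comp

theorem dist_unitPoint (i j n : ℕ) :
    dist (unitPoint i) (unitPoint j) = ((ratOfNat (unitDistCode (i, j, n)) : ℚ) : ℝ) := by
  rw [Subtype.dist_eq, Real.dist_eq]
  simp only [unitPoint, unitDistCode, ratOfNat, Nat.unpair_pair]
  generalize i.unpair.2 = b
  generalize j.unpair.2 = d
  generalize min i.unpair.1 (b + 1) = a
  generalize min j.unpair.1 (d + 1) = c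
  have hden : (((b + 1) * (d + 1) - 1 : ℕ) : ℝ) + 1 = ((b : ℝ) + 1) * ((d : ℝ) + 1) := by
    have : (b + 1) * (d + 1) - 1 + 1 = (b + 1) * (d + 1) :=
      Nat.sub_add_cancel (Nat.mul_pos (Nat.succ_pos _) (Nat.succ_pos _))
    exact_mod_cast this
  have hb : (0 : ℝ) < (b : ℝ) + 1 := by positivity
  have hd : (0 : ℝ) < (d : ℝ) + 1 := by positivity
  have hnum : ((a * (d + 1) - c * (b + 1) + (c * (b + 1) - a * (d + 1)) : ℕ) : ℝ)
      = |(a : ℝ) * ((d : ℝ) + 1) - (c : ℝ) * ((b : ℝ) + 1)| := by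
    rcases le_total (a * (d + 1)) (c * (b + 1)) with h | h
    · have h' : (a : ℝ) * ((d : ℝ) + 1) ≤ (c : ℝ) * ((b : ℝ) + 1) := by exact_mod_cast h
      rw [Nat.sub_eq_zero_of_le h, zero_add, Nat.cast_sub h, abs_of_nonpos (by linarith)]
      push_cast; ring
    · have h' : (c : ℝ) * ((b : ℝ) + 1) ≤ (a : ℝ) * ((d : ℝ) + 1) := by exact_mod_cast h
      rw [Nat.sub_eq_zero_of_le h, add_zero, Nat.cast_sub h, abs_of_nonneg (by linarith)]
      push_cast; ring
  rw [Rat.cast_div, Rat.cast_sub, Rat.cast_add, Rat.cast_natCast, Rat.cast_natCast,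
    Rat.cast_natCast, hnum, Rat.cast_one, hden]
  push_cast
  rw [sub_zero, div_sub_div _ _ hb.ne' hd.ne', abs_div, abs_of_pos (mul_pos hb hd)]
  congr 2
  ring

/-- The unit interval, with its usual metric and the rationals in `[0, 1]` as ideal points. -/
noncomputable instance : ComputableMetricSpace unitInterval where
  point := unitPoint
  dense_point := denseRange_unitPoint
  dist_computable := ⟨unitDistCode, computable_unitDistCode, fun i j n => by
    rw [← dist_unitPoint i j n, sub_self, abs_zero]
    positivity⟩

-- The map is a zigzag with four laps of slope ±5 whose last lap is cut off at a height `t`, so that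
-- it ends in a plateau of value `t`. A set of points that never reach `t` is carried into itself by
-- four affine branches of slope ±5, so its measure `a` satisfies `a ≤ (4/5) a` and vanishes
-- (`volume_setOf_never_hit`). Almost every orbit therefore merges with the orbit of `t`, and `ω(t)`
-- is a metric attractor (`isMetricAttractor_limitSet`).
--
-- The height `t` is chosen with base-5 digits 0 and 2 only. On such points the map is the digit
-- shift (`foldReal_digitTail`), and the plateau is never met, so `ω(t)` consists of the cluster
-- points of the shifted digit sequences.
--
-- The digits are `2 0^(a 0) 2 0^(a 1) 2 …`, where `a` takes the value `k + 1` infinitely often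
-- exactly when the `k`-th program halts on infinitely many inputs
-- (`infinite_haltingSeq_eq_succ_iff`). A small closed ball around `0.2 0^(k+1) 2` then misses
-- `ω(t)` exactly when that domain is finite (`wordBall_mem_outerCollection_iff`). Finiteness of the
-- domain is a `Σ₂`-complete property (`IsSigmaTwo.exists_finite_dom`), so the outer collection is
-- `Σ₂`-hard. It is `Σ₂` by compactness, because the orbit is computable
-- (`isSigmaTwo_outerCollection`). Many-one completeness implies completeness for enumeration
-- operators.

open MeasureTheory Filter Topology

/-! ### A universal sequence for `Π₂` sets -/

/-- The code stored in the first component of a stage `⟨k, ⟨x, s⟩⟩`, run for `s` steps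
on the input `x`. -/
def runStage (k x s : ℕ) : Option ℕ :=
  Nat.Partrec.Code.evaln s (Denumerable.ofNat Nat.Partrec.Code k) x

/-- At the stage `⟨k, ⟨x, s⟩⟩` the value is `k + 1` if the `k`-th program halts on the input `x`
within `s + 1` steps but not within `s`, and it is `0` otherwise. -/
def haltingSeq (n : ℕ) : ℕ :=
  if (runStage n.unpair.1 n.unpair.2.unpair.1 (n.unpair.2.unpair.2 + 1)).isSome = true ∧
      (runStage n.unpair.1 n.unpair.2.unpair.1 n.unpair.2.unpair.2).isSome = false
    then n.unpair.1 + 1 else 0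

theorem primrec_haltingSeq : Primrec haltingSeq := by
  have hk : Primrec (fun n : ℕ => n.unpair.1) := Primrec.fst.comp Primrec.unpair
  have hxs : Primrec (fun n : ℕ => n.unpair.2.unpair) :=
    Primrec.unpair.comp (Primrec.snd.comp Primrec.unpair)
  have hx := Primrec.fst.comp hxs
  have hs := Primrec.snd.comp hxs
  have hc := (Primrec.ofNat Nat.Partrec.Code).comp hk
  have h1 := Primrec.option_isSome.comp
    (Nat.Partrec.Code.primrec_evaln.comp (((Primrec.succ.comp hs).pair hc).pair hx))
  have h2 := Primrec.option_isSome.comp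
    (Nat.Partrec.Code.primrec_evaln.comp ((hs.pair hc).pair hx))
  exact Primrec.ite ((Primrec.eq.comp h1 (Primrec.const true)).and
    (Primrec.eq.comp h2 (Primrec.const false))) (Primrec.succ.comp hk) (Primrec.const 0)

theorem runStage_isSome_mono {k x s s' : ℕ} (h : s ≤ s') (hs : (runStage k x s).isSome = true) :
    (runStage k x s').isSome = true := by
  obtain ⟨y, hy⟩ := Option.isSome_iff_exists.1 hs
  exact Option.isSome_iff_exists.2 ⟨y, Nat.Partrec.Code.evaln_mono h hy⟩

theorem haltingSeq_eq_succ_iff (n k : ℕ) : haltingSeq n = k + 1 ↔ n.unpair.1 = k ∧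
    (runStage k n.unpair.2.unpair.1 (n.unpair.2.unpair.2 + 1)).isSome = true ∧
      (runStage k n.unpair.2.unpair.1 n.unpair.2.unpair.2).isSome = false := by
  unfold haltingSeq
  split_ifs with h
  · constructor
    · intro hk
      obtain rfl : n.unpair.1 = k := by omega
      exact ⟨rfl, h⟩
    · rintro ⟨rfl, -⟩; rfl
  · constructor
    · exact False.elim
    · rintro ⟨rfl, h'⟩; exact absurd h' h

/-- Each input on which the program halts contributes exactly one stage, the one where halting is
first seen. Stages carrying the value `k + 1` thus correspond bijectively to the domain. -/
theorem infinite_haltingSeq_eq_succ_iff (k : ℕ) : {n | haltingSeq n = k + 1}.Infinite ↔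
    {x | (Nat.Partrec.Code.eval (Denumerable.ofNat Nat.Partrec.Code k) x).Dom}.Infinite := by
  constructor
  · intro h
    refine Set.infinite_of_injOn_mapsTo (f := fun n : ℕ => n.unpair.2.unpair.1) ?_ ?_ h
    · intro n hn m hm hnm
      obtain ⟨hn1, hn2, hn3⟩ := (haltingSeq_eq_succ_iff n k).1 hn
      obtain ⟨hm1, hm2, hm3⟩ := (haltingSeq_eq_succ_iff m k).1 hm
      simp only at hnm
      rw [← hnm] at hm2 hm3
      have hs : n.unpair.2.unpair.2 = m.unpair.2.unpair.2 := by
        rcases lt_trichotomy n.unpair.2.unpair.2 m.unpair.2.unpair.2 with h' | h' | h'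
        · rw [runStage_isSome_mono h' hn2] at hm3; cases hm3
        · exact h'
        · rw [runStage_isSome_mono h' hm2] at hn3; cases hn3
      rw [← Nat.pair_unpair n, ← Nat.pair_unpair m, ← Nat.pair_unpair n.unpair.2,
        ← Nat.pair_unpair m.unpair.2, hn1, hm1, hnm, hs]
    · intro n hn
      obtain ⟨-, hn2, -⟩ := (haltingSeq_eq_succ_iff n k).1 hn
      obtain ⟨y, hy⟩ := Option.isSome_iff_exists.1 hn2
      exact Part.dom_iff_mem.2 ⟨y, Nat.Partrec.Code.evaln_sound hy⟩
  · intro h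
    have hex : ∀ x, (Nat.Partrec.Code.eval (Denumerable.ofNat Nat.Partrec.Code k) x).Dom →
        ∃ s, (runStage k x (s + 1)).isSome = true ∧ (runStage k x s).isSome = false := by
      classical
      intro x hx
      obtain ⟨y, hy⟩ := Part.dom_iff_mem.1 hx
      obtain ⟨s, hs⟩ := Nat.Partrec.Code.evaln_complete.1 hy
      have hP : ∃ s, (runStage k x s).isSome = true := ⟨s, Option.isSome_iff_exists.2 ⟨y, hs⟩⟩
      -- With 0 steps `evaln` returns `none`, so the first successful bound has a predecessor.
      have hpos : Nat.find hP ≠ 0 := by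
        intro h0
        have := Nat.find_spec hP
        rw [h0] at this
        simp [runStage, Nat.Partrec.Code.evaln] at this
      refine ⟨Nat.find hP - 1, ?_, ?_⟩
      · rw [Nat.sub_add_cancel (Nat.pos_of_ne_zero hpos)]
        exact Nat.find_spec hP
      · simpa using Nat.find_min hP (Nat.sub_lt (Nat.pos_of_ne_zero hpos) one_pos)
    choose! s hs1 hs2 using hex
    refine Set.infinite_of_injOn_mapsTo (f := fun x : ℕ => Nat.pair k (Nat.pair x (s x))) ?_ ?_ h
    · intro x _ y _ hxy
      simp only [Nat.pair_eq_pair] at hxy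
      exact hxy.2.1
    · intro x hx
      exact (haltingSeq_eq_succ_iff _ k).2 (by
        simp only [Nat.unpair_pair]
        exact ⟨trivial, hs1 x hx, hs2 x hx⟩)

/-- Every `Σ₂` set is many-one reducible to the set of programs with finite domain. -/
theorem IsSigmaTwo.exists_finite_dom {S : Set ℕ} (hS : IsSigmaTwo S) :
    ∃ g : ℕ → ℕ, Computable g ∧ ∀ i, i ∈ S ↔
      {x | (Nat.Partrec.Code.eval (Denumerable.ofNat Nat.Partrec.Code (g i)) x).Dom}.Finite := by
  obtain ⟨R, hR, hSR⟩ := hS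
  -- `witness i a` searches for a counterexample `b` to `∀ b, R (i, a, b)`
  let witness : ℕ × ℕ →. ℕ := fun p => Nat.rfind fun b => Part.some (!R (p.1, p.2, b))
  have hwit : Partrec witness := by
    refine Partrec.rfind (p := fun (p : ℕ × ℕ) b => Part.some (!R (p.1, p.2, b))) ?_
    have : Computable (fun q : (ℕ × ℕ) × ℕ => !R (q.1.1, q.1.2, q.2)) :=
      Primrec.not.to_comp.comp (hR.comp ((Computable.fst.comp Computable.fst).pair
        ((Computable.snd.comp Computable.fst).pair Computable.snd)))
    exact this.partrec
  have hwdom : ∀ i a, (witness (i, a)).Dom ↔ ∃ b, R (i, a, b) = false := by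
    intro i a
    refine Nat.rfind_dom.trans ?_
    simp
  -- On `⟨i, x⟩` this runs the searches for all `a < x` in turn. For fixed `i` the domain is an
  -- initial segment of `ℕ`, and it is finite iff some `a` has no counterexample.
  let ψ : ℕ →. ℕ := fun n => n.unpair.2.rec (Part.some 0)
    (fun a (r : Part ℕ) => r.bind fun _ => witness (n.unpair.1, a))
  have hψ : Partrec ψ := by
    refine Partrec.nat_rec (f := fun n : ℕ => n.unpair.2) (g := fun _ => Part.some 0)
      (h := fun n (q : ℕ × ℕ) => witness (n.unpair.1, q.1)) ?_ ?_ ?_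
    · exact (Primrec.snd.comp Primrec.unpair).to_comp
    · exact (Computable.const 0).partrec
    · exact hwit.comp (((Primrec.fst.comp (Primrec.unpair.comp Primrec.fst)).pair
        (Primrec.fst.comp Primrec.snd)).to_comp)
  have hψdom : ∀ i x, (ψ (Nat.pair i x)).Dom ↔ ∀ a < x, ∃ b, R (i, a, b) = false := by
    intro i x
    simp only [ψ, Nat.unpair_pair]
    induction x with
    | zero => simp
    | succ x ih =>
      rw [Nat.forall_lt_succ_right, ← ih, ← hwdom]
      simp [Part.bind_dom]
  obtain ⟨c, hc⟩ := Nat.Partrec.Code.exists_code.1 (Partrec.nat_iff.1 hψ)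
  refine ⟨fun i => Encodable.encode (Nat.Partrec.Code.curry c i), ?_, fun i => ?_⟩
  · exact (Primrec.encode.comp (Nat.Partrec.Code.primrec₂_curry.comp (Primrec.const c)
      Primrec.id)).to_comp
  · simp only [Denumerable.ofNat_encode, Nat.Partrec.Code.eval_curry, hc, hψdom]
    rw [hSR]
    constructor
    · rintro ⟨a, ha⟩
      refine (Set.finite_Iic a).subset fun x hx => ?_
      by_contra hax
      obtain ⟨b, hb⟩ := hx a (not_le.1 hax)
      rw [ha b] at hb
      cases hb
    · intro hfin
      by_contra! hne
      refine Set.infinite_univ (hfin.subset fun x _ a _ => ?_)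
      obtain ⟨b, hb⟩ := hne a
      exact ⟨b, by simpa using hb⟩

/-! ### The digit sequence -/

/-- The position of the `n`-th digit `2` in `2 0^(a 0) 2 0^(a 1) 2 …`. -/
def blockStart (a : ℕ → ℕ) (n : ℕ) : ℕ :=
  Nat.rec 0 (fun i s => s + a i + 1) n

theorem blockStart_succ (a : ℕ → ℕ) (n : ℕ) :
    blockStart a (n + 1) = blockStart a n + a n + 1 := rfl

theorem strictMono_blockStart (a : ℕ → ℕ) : StrictMono (blockStart a) :=
  strictMono_nat_of_lt_succ fun n => by rw [blockStart_succ]; omega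

theorem primrec_blockStart {a : ℕ → ℕ} (ha : Primrec a) : Primrec (blockStart a) :=
  Primrec.nat_rec₁ 0 (Primrec.succ.comp (Primrec.nat_add.comp Primrec.snd (ha.comp Primrec.fst)))

/-- The digits of `2 0^(a 0) 2 0^(a 1) 2 …`. -/
def blockDigit (a : ℕ → ℕ) (n : ℕ) : ℕ :=
  if ∃ i < n + 1, blockStart a i = n then 2 else 0

/-- The bound on `i` in `blockDigit` only serves primitive recursion. It loses nothing, since `i ≤
blockStart a i`. -/
theorem blockDigit_eq_two_iff (a : ℕ → ℕ) (n : ℕ) :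
    blockDigit a n = 2 ↔ ∃ i, blockStart a i = n := by
  unfold blockDigit
  split_ifs with h
  · obtain ⟨i, -, hi⟩ := h
    exact ⟨fun _ => ⟨i, hi⟩, fun _ => rfl⟩
  · refine ⟨fun h' => (by cases h'), ?_⟩
    rintro ⟨i, hi⟩
    exact absurd ⟨i, Nat.lt_succ_of_le (hi ▸ (strictMono_blockStart a).le_apply), hi⟩ h

theorem blockDigit_eq_zero_or_two (a : ℕ → ℕ) (n : ℕ) :
    blockDigit a n = 0 ∨ blockDigit a n = 2 := by
  unfold blockDigit
  split_ifs
  · exact Or.inr rfl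
  · exact Or.inl rfl

theorem primrec_blockDigit {a : ℕ → ℕ} (ha : Primrec a) : Primrec (blockDigit a) := by
  have h : PrimrecRel (fun i n : ℕ => blockStart a i = n) :=
    Primrec.eq.comp ((primrec_blockStart ha).comp Primrec.fst) Primrec.snd
  have h' : PrimrecPred (fun n : ℕ => ∃ i < n + 1, blockStart a i = n) :=
    h.exists_lt.comp Primrec.succ Primrec.id
  exact Primrec.ite h' (Primrec.const 2) (Primrec.const 0)

/-- The integer with base-`5` digits `c p, c (p + 1), …, c (p + l - 1)`. -/
def digitWord (c : ℕ → ℕ) (p l : ℕ) : ℕ :=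
  Nat.rec 0 (fun j u => 5 * u + c (p + j)) l

theorem digitWord_succ (c : ℕ → ℕ) (p l : ℕ) :
    digitWord c p (l + 1) = 5 * digitWord c p l + c (p + l) := rfl

theorem primrec_digitWord {c : ℕ → ℕ} (hc : Primrec c) : Primrec₂ (digitWord c) := by
  refine Primrec.nat_rec' (f := fun q : ℕ × ℕ => q.2) (g := fun _ => 0)
    (h := fun q r => 5 * r.2 + c (q.1 + r.1)) Primrec.snd (Primrec.const 0) ?_
  exact Primrec.nat_add.comp
    (Primrec.nat_mul.comp (Primrec.const 5) (Primrec.snd.comp Primrec.snd))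
    (hc.comp (Primrec.nat_add.comp (Primrec.fst.comp Primrec.fst)
      (Primrec.fst.comp Primrec.snd)))

/-- Parity makes the values of distinct words differ by at least 2, which yields the gap in
`le_dist_wordBall`. -/
theorem even_digitWord {c : ℕ → ℕ} (hc : ∀ n, c n = 0 ∨ c n = 2) (p l : ℕ) :
    Even (digitWord c p l) := by
  induction l with
  | zero => exact Even.zero
  | succ l ih =>
    rw [digitWord_succ]
    refine (ih.mul_left 5).add ?_
    rcases hc (p + l) with h | h <;> rw [h] <;> decide

theorem digitWord_eq_two_mul_pow_iff {c : ℕ → ℕ} (hc : ∀ n, c n = 0 ∨ c n = 2) (p k : ℕ) :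
    digitWord c p (k + 1) = 2 * 5 ^ k ↔ c p = 2 ∧ ∀ j < k, c (p + j + 1) = 0 := by
  induction k with
  | zero => simp [digitWord]
  | succ k ih =>
    rw [digitWord_succ, Nat.forall_lt_succ_right, ← and_assoc, ← ih, pow_succ, ← add_assoc]
    rcases hc (p + k + 1) with h | h <;> omega

/-- The number on the right is the value of the word `2 0^k 2`. Two consecutive digits 2 delimit
exactly one block, whose length is then `k`. -/
theorem digitWord_blockDigit_eq_iff (a : ℕ → ℕ) (p k : ℕ) :
    digitWord (blockDigit a) p (k + 2) = 2 * 5 ^ (k + 1) + 2 ↔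
      ∃ i, blockStart a i = p ∧ a i = k := by
  have hc := blockDigit_eq_zero_or_two a
  have hsplit : digitWord (blockDigit a) p (k + 2) = 2 * 5 ^ (k + 1) + 2 ↔
      (blockDigit a p = 2 ∧ ∀ j < k, blockDigit a (p + j + 1) = 0) ∧
        blockDigit a (p + k + 1) = 2 := by
    rw [digitWord_succ, ← digitWord_eq_two_mul_pow_iff hc, pow_succ, ← add_assoc]
    rcases hc (p + k + 1) with h | h <;> omega
  rw [hsplit]
  constructor
  · rintro ⟨⟨h2, h0⟩, h2'⟩
    obtain ⟨i, hi⟩ := (blockDigit_eq_two_iff a _).1 h2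
    obtain ⟨j, hj⟩ := (blockDigit_eq_two_iff a _).1 h2'
    refine ⟨i, hi, le_antisymm ?_ ?_⟩
    · have hij : i < j := (strictMono_blockStart a).lt_iff_lt.1 (by omega)
      have := (strictMono_blockStart a).monotone (Nat.succ_le_of_lt hij)
      rw [Nat.succ_eq_add_one, blockStart_succ] at this
      omega
    · by_contra! hlt
      have h3 := h0 _ hlt
      rw [← hi, ← blockStart_succ, (blockDigit_eq_two_iff a _).2 ⟨i + 1, rfl⟩] at h3
      cases h3
  · rintro ⟨i, rfl, rfl⟩
    refine ⟨⟨(blockDigit_eq_two_iff a _).2 ⟨i, rfl⟩, fun j hj => ?_⟩,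
      (blockDigit_eq_two_iff a _).2 ⟨i + 1, rfl⟩⟩
    refine (hc _).resolve_right fun h => ?_
    obtain ⟨m, hm⟩ := (blockDigit_eq_two_iff a _).1 h
    have h1 : i < m := (strictMono_blockStart a).lt_iff_lt.1 (by omega)
    have h2 : m < i + 1 := (strictMono_blockStart a).lt_iff_lt.1 (by rw [blockStart_succ]; omega)
    omega

theorem infinite_digitWord_eq_iff (a : ℕ → ℕ) (k : ℕ) :
    {p | digitWord (blockDigit a) p (k + 2) = 2 * 5 ^ (k + 1) + 2}.Infinite ↔
      {i | a i = k}.Infinite := by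
  have h : {p | digitWord (blockDigit a) p (k + 2) = 2 * 5 ^ (k + 1) + 2} =
      blockStart a '' {i | a i = k} := by
    ext p
    simp only [Set.mem_ofPred_eq, Set.mem_image, digitWord_blockDigit_eq_iff]
    exact exists_congr fun i => and_comm
  rw [h, Set.infinite_image_iff (strictMono_blockStart a).injective.injOn]

/-! ### Real numbers from digit sequences -/

/-- The real number with base-`5` digits `c p, c (p + 1), …` after the point. -/
noncomputable def digitTail (c : ℕ → ℕ) (p : ℕ) : ℝ :=
  ∑' j, (c (p + j) : ℝ) / 5 ^ (j + 1)

section digitTail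

variable {c : ℕ → ℕ}

theorem hasSum_two_div_five_pow : HasSum (fun j : ℕ => (2 : ℝ) / 5 ^ (j + 1)) (1 / 2) := by
  have h := (hasSum_geometric_of_lt_one (r := (1 / 5 : ℝ)) (by norm_num) (by norm_num)).mul_left
    (2 / 5)
  have h1 : (fun j : ℕ => (2 : ℝ) / 5 ^ (j + 1)) = fun j => 2 / 5 * (1 / 5) ^ j := by
    funext j
    rw [pow_succ, one_div, inv_pow]
    field_simp
  rw [h1, show (1 / 2 : ℝ) = 2 / 5 * (1 - 1 / 5)⁻¹ by norm_num]
  exact h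

theorem digit_div_nonneg (p j : ℕ) : (0 : ℝ) ≤ (c (p + j) : ℝ) / 5 ^ (j + 1) := by positivity

theorem digit_div_le (hc : ∀ n, c n = 0 ∨ c n = 2) (p j : ℕ) :
    (c (p + j) : ℝ) / 5 ^ (j + 1) ≤ 2 / 5 ^ (j + 1) := by
  gcongr
  rcases hc (p + j) with h | h <;> rw [h] <;> norm_num

theorem summable_digitTail (hc : ∀ n, c n = 0 ∨ c n = 2) (p : ℕ) :
    Summable fun j : ℕ => (c (p + j) : ℝ) / 5 ^ (j + 1) :=
  Summable.of_nonneg_of_le (digit_div_nonneg p) (digit_div_le hc p)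
    hasSum_two_div_five_pow.summable

theorem digitTail_nonneg (p : ℕ) : 0 ≤ digitTail c p := tsum_nonneg (digit_div_nonneg p)

/-- This keeps digit points on the first and third laps, away from the plateau, which lies to the
right of `3/5`. -/
theorem digitTail_le_half (hc : ∀ n, c n = 0 ∨ c n = 2) (p : ℕ) : digitTail c p ≤ 1 / 2 :=
  hasSum_two_div_five_pow.tsum_eq ▸
    (summable_digitTail hc p).tsum_le_tsum (digit_div_le hc p) hasSum_two_div_five_pow.summable

theorem digitTail_eq (hc : ∀ n, c n = 0 ∨ c n = 2) (p : ℕ) :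
    5 * digitTail c p = c p + digitTail c (p + 1) := by
  have h : digitTail c p = (c p : ℝ) / 5 + digitTail c (p + 1) / 5 := by
    unfold digitTail
    rw [(summable_digitTail hc p).tsum_eq_zero_add, ← tsum_div_const]
    congr 1
    · simp
    · refine tsum_congr fun j => ?_
      rw [pow_succ _ (j + 1), div_mul_eq_div_div]
      congr 4
      omega
  rw [h]
  ring

theorem digitTail_eq_digitWord_add (hc : ∀ n, c n = 0 ∨ c n = 2) (p l : ℕ) :
    5 ^ l * digitTail c p = digitWord c p l + digitTail c (p + l) := by
  induction l with
  | zero => simp [digitWord]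
  | succ l ih =>
    rw [digitWord_succ, pow_succ', mul_assoc, ih, mul_add, digitTail_eq hc]
    push_cast
    rw [add_assoc p l 1]
    ring

theorem abs_digitTail_sub_le (hc : ∀ n, c n = 0 ∨ c n = 2) (p l : ℕ) :
    |digitTail c p - digitWord c p l / 5 ^ l| ≤ 1 / 5 ^ l := by
  have h5 : (0 : ℝ) < 5 ^ l := by positivity
  have h : digitTail c p - digitWord c p l / 5 ^ l = digitTail c (p + l) / 5 ^ l := by
    rw [sub_eq_iff_eq_add, ← add_div, eq_div_iff h5.ne', mul_comm, add_comm,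
      digitTail_eq_digitWord_add hc]
  rw [h, abs_of_nonneg (div_nonneg (digitTail_nonneg _) h5.le)]
  gcongr
  linarith [digitTail_le_half hc (p + l)]

end digitTail

/-! ### The map -/

/-- The piecewise linear map with slopes `5, -5, 5, -5` that is cut off at the height `t`
on its last lap. -/
noncomputable def foldReal (t x : ℝ) : ℝ :=
  min (5 * x) (max (2 - 5 * x) (min (5 * x - 2) (max t (4 - 5 * x))))

theorem foldReal_mem {t x : ℝ} (ht : t ∈ Set.Icc (0 : ℝ) 1) (hx : x ∈ Set.Icc (0 : ℝ) 1) :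
    foldReal t x ∈ Set.Icc (0 : ℝ) 1 := by
  obtain ⟨ht0, ht1⟩ := ht
  obtain ⟨hx0, hx1⟩ := hx
  unfold foldReal
  constructor
  · refine le_min (by linarith) ?_
    rcases le_total (5 * x) 2 with h | h
    · exact le_max_of_le_left (by linarith)
    · exact le_max_of_le_right (le_min (by linarith) (le_max_of_le_left ht0))
  · rcases le_total (5 * x) 1 with h | h
    · exact min_le_of_left_le h
    · refine min_le_of_right_le (max_le (by linarith) ?_)
      rcases le_total (5 * x) 3 with h' | h'
      · exact min_le_of_left_le (by linarith)
      · exact min_le_of_right_le (max_le ht1 (by linarith))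

/-- A point not sent to `t` at once is moved by one of four affine maps. Their form `b + m * x` fits
`volume_preimage_add_mul`. -/
theorem foldReal_cases (t x : ℝ) : foldReal t x = t ∨ foldReal t x = 5 * x ∨
    foldReal t x = 2 + -5 * x ∨ foldReal t x = -2 + 5 * x ∨ foldReal t x = 4 + -5 * x := by
  unfold foldReal
  rcases min_choice (5 * x) (max (2 - 5 * x) (min (5 * x - 2) (max t (4 - 5 * x)))) with h | h
  · exact .inr (.inl h)
  rw [h]
  rcases max_choice (2 - 5 * x) (min (5 * x - 2) (max t (4 - 5 * x))) with h | h
  · exact .inr (.inr (.inl (by rw [h]; ring)))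
  rw [h]
  rcases min_choice (5 * x - 2) (max t (4 - 5 * x)) with h | h
  · exact .inr (.inr (.inr (.inl (by rw [h]; ring))))
  rw [h]
  rcases max_choice t (4 - 5 * x) with h | h
  · exact .inl h
  · exact .inr (.inr (.inr (.inr (by rw [h]; ring))))

/-- `min` and `max` are nonexpanding for the sup distance. The estimate covers the cut-off height as
well, so that `t` may be replaced by a rational approximation. -/
theorem abs_foldReal_sub_le (t s x y : ℝ) :
    |foldReal t x - foldReal s y| ≤ max |t - s| (5 * |x - y|) := by
  have h5 : |5 * x - 5 * y| = 5 * |x - y| := by rw [← mul_sub, abs_mul]; norm_num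
  have h5' : ∀ k : ℝ, |k - 5 * x - (k - 5 * y)| = 5 * |x - y| := fun k => by
    rw [← h5, ← abs_neg]; congr 1; ring
  have h5'' : |5 * x - 2 - (5 * y - 2)| = 5 * |x - y| := by rw [← h5]; congr 1; ring
  unfold foldReal
  refine (abs_min_sub_min_le_max _ _ _ _).trans (max_le (h5.le.trans (le_max_right _ _)) ?_)
  refine (abs_max_sub_max_le_max _ _ _ _).trans (max_le ((h5' 2).le.trans (le_max_right _ _)) ?_)
  refine (abs_min_sub_min_le_max _ _ _ _).trans (max_le (h5''.le.trans (le_max_right _ _)) ?_)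
  refine (abs_max_sub_max_le_max _ _ _ _).trans ?_
  rw [h5' 4]

/-- `foldReal t` as a self-map of the unit interval. -/
noncomputable def foldMap (t x : unitInterval) : unitInterval :=
  ⟨foldReal t x, foldReal_mem t.2 x.2⟩

theorem continuous_foldMap (t : unitInterval) : Continuous (foldMap t) := by
  refine Continuous.subtype_mk ?_ _
  unfold foldReal
  fun_prop

/-! ### Almost every orbit hits the cut-off height -/

theorem volume_preimage_add_mul (b : ℝ) {m : ℝ} (hm : |m| = 5) (s : Set ℝ) :
    volume ((fun x => b + m * x) ⁻¹' s) = ENNReal.ofReal 5⁻¹ * volume s := by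
  have hm0 : m ≠ 0 := by rintro rfl; norm_num at hm
  have h : (fun x => b + m * x) ⁻¹' s = (fun x => m * x) ⁻¹' ((fun y => b + y) ⁻¹' s) := rfl
  rw [h, Real.volume_preimage_mul_left hm0, measure_preimage_add, abs_inv, hm]

theorem measure_eq_zero_of_le_four_fifths_mul {a : ENNReal} (ha : a ≠ ⊤)
    (h : a ≤ ENNReal.ofReal (4 / 5) * a) : a = 0 := by
  lift a to NNReal using ha
  have h' : a ≤ Real.toNNReal (4 / 5) * a := by
    rw [ENNReal.ofReal] at h
    exact_mod_cast h
  have h'' : (a : ℝ) ≤ 4 / 5 * a := by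
    have := NNReal.coe_le_coe.2 h'
    rwa [NNReal.coe_mul, Real.coe_toNNReal _ (by norm_num)] at this
  have h0 : (a : ℝ) = 0 := by linarith [a.2, show (0 : ℝ) ≤ a from a.2]
  exact_mod_cast h0

theorem volume_setOf_never_hit (t : unitInterval) :
    volume {x : unitInterval | ∀ n, (foldMap t)^[n] x ≠ t} = 0 := by
  set N : Set unitInterval := {x | ∀ n, (foldMap t)^[n] x ≠ t} with hN
  set M : Set ℝ := Subtype.val '' N with hM
  have hvol : volume N = volume M :=
    (MeasurableEmbedding.subtype_coe measurableSet_Icc).comap_apply volume N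
  -- Only monotonicity, subadditivity and affine scaling are applied to this covering, and they hold
  -- for outer measure, so `M` need not be shown measurable.
  have hsub : M ⊆ (((fun x => 0 + 5 * x) ⁻¹' M ∪ (fun x => 2 + -5 * x) ⁻¹' M) ∪
      (fun x => -2 + 5 * x) ⁻¹' M) ∪ (fun x => 4 + -5 * x) ⁻¹' M := by
    rintro _ ⟨x, hx, rfl⟩
    have hfx : (foldMap t x : ℝ) ∈ M := by
      refine ⟨foldMap t x, fun n => ?_, rfl⟩
      rw [← Function.iterate_succ_apply]
      exact hx (n + 1)
    have hne : foldReal t x ≠ t := fun h => hx 1 (Subtype.ext h)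
    simp only [Set.mem_union, Set.mem_preimage]
    rcases foldReal_cases t x with h | h | h | h | h
    · exact absurd h hne
    · rw [zero_add, ← h]; exact .inl (.inl (.inl hfx))
    · rw [← h]; exact .inl (.inl (.inr hfx))
    · rw [← h]; exact .inl (.inr hfx)
    · rw [← h]; exact .inr hfx
  have hle : volume M ≤ ENNReal.ofReal (4 / 5) * volume M := by
    calc volume M
        ≤ volume ((fun x => 0 + 5 * x) ⁻¹' M) + volume ((fun x => 2 + -5 * x) ⁻¹' M) +
          volume ((fun x => -2 + 5 * x) ⁻¹' M) + volume ((fun x => 4 + -5 * x) ⁻¹' M) :=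
          (measure_mono hsub).trans <| (measure_union_le _ _).trans <| by
            gcongr
            refine (measure_union_le _ _).trans ?_
            gcongr
            exact measure_union_le _ _
      _ = ENNReal.ofReal (4 / 5) * volume M := by
          simp only [volume_preimage_add_mul _ (show |(5 : ℝ)| = 5 by norm_num),
            volume_preimage_add_mul _ (show |(-5 : ℝ)| = 5 by norm_num), ← add_mul]
          congr 1
          rw [← ENNReal.ofReal_add (by norm_num) (by norm_num),
            ← ENNReal.ofReal_add (by norm_num) (by norm_num),
            ← ENNReal.ofReal_add (by norm_num) (by norm_num)]
          norm_num
  have hfin : volume M ≠ ⊤ := by rw [← hvol]; exact measure_ne_top _ _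
  rw [hvol]
  exact measure_eq_zero_of_le_four_fifths_mul hfin hle

/-! ### Limit sets -/

section limitSet

variable {X : Type*}

theorem isClosed_limitSet [TopologicalSpace X] (T : X → X) (x : X) : IsClosed (limitSet T x) :=
  isClosed_setOfPred_clusterPt

theorem limitSet_iterate [TopologicalSpace X] (T : X → X) (n : ℕ) (x : X) :
    limitSet T (T^[n] x) = limitSet T x := by
  ext y
  change ClusterPt y (map (fun k : ℕ => T^[k] (T^[n] x)) atTop) ↔
    ClusterPt y (map (fun k : ℕ => T^[k] x) atTop)
  conv_rhs => rw [← map_add_atTop_eq_nat n, Filter.map_map]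
  simp only [← Function.iterate_add_apply]
  rfl

theorem mapsTo_limitSet [TopologicalSpace X] {T : X → X} (hT : Continuous T) (x : X) :
    Set.MapsTo T (limitSet T x) (limitSet T x) := by
  intro y hy
  have h : MapClusterPt (T y) atTop (T ∘ fun n : ℕ => T^[n] x) :=
    MapClusterPt.continuousAt_comp hT.continuousAt hy
  rw [← limitSet_iterate T 1 x]
  change MapClusterPt (T y) atTop _
  convert h using 2 with n
  simp only [Function.comp_apply, ← Function.iterate_succ_apply', ← Function.iterate_succ_apply,
    Function.iterate_one]

/-- Every orbit that hits `t` has the same limit set as `t`. A realm containing just one such point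
already forces its set to contain `limitSet T t`. -/
theorem isMetricAttractor_limitSet [TopologicalSpace X] [CompactSpace X] [MeasurableSpace X]
    {μ : Measure X} {T : X → X} (hT : Continuous T) {t : X}
    (h : μ {x | ∀ n, T^[n] x ≠ t} = 0) : IsMetricAttractor μ T (limitSet T t) := by
  have hlim : ∀ x, x ∉ {x | ∀ n, T^[n] x ≠ t} → limitSet T x = limitSet T t := by
    intro x hx
    simp only [Set.mem_ofPred_eq, not_forall, not_not] at hx
    obtain ⟨n, hn⟩ := hx
    rw [← hn, limitSet_iterate]
  refine ⟨isClosed_limitSet T t, mapsTo_limitSet hT t, measure_mono_null (fun x hx => ?_) h,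
    fun A' _ hA' => measure_mono_null (fun x hx => ?_) h⟩
  · by_contra hx'
    exact hx (hlim x hx').subset
  · by_contra hx'
    refine hA'.2 ?_
    rw [← hlim x hx']
    exact hx

theorem le_dist_of_mapClusterPt [PseudoMetricSpace X] {u : ℕ → X} {y z : X} {r : ℝ}
    (hy : MapClusterPt y atTop u) (h : ∀ᶠ n in atTop, r ≤ dist (u n) z) : r ≤ dist y z := by
  by_contra! hlt
  obtain ⟨n, hn1, hn2⟩ := ((hy.frequently
    ((isOpen_lt (continuous_id.dist continuous_const) continuous_const).mem_nhds hlt)).and_eventually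
      h).exists
  exact absurd hn2 (not_le.2 hn1)

theorem exists_mapClusterPt_dist_le [PseudoMetricSpace X] [CompactSpace X] {u : ℕ → X} {z : X}
    {r : ℝ} (h : ∀ ε > 0, ∃ᶠ n in atTop, dist (u n) z ≤ r + ε) :
    ∃ y, MapClusterPt y atTop u ∧ dist y z ≤ r := by
  obtain ⟨φ, hφ, hφd⟩ := extraction_forall_of_frequently
    (P := fun n k => dist (u k) z ≤ r + 1 / ((n : ℝ) + 1)) fun n => h _ (by positivity)
  obtain ⟨y, ψ, hψ, hy⟩ := CompactSpace.tendsto_subseq (u ∘ φ)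
  refine ⟨y, ?_, ?_⟩
  · exact MapClusterPt.of_comp (hφ.comp hψ).tendsto_atTop hy.mapClusterPt
  · have h1 : Tendsto (fun n : ℕ => r + 1 / ((n : ℝ) + 1)) atTop (𝓝 (r + 0)) :=
      tendsto_const_nhds.add tendsto_one_div_add_atTop_nhds_zero_nat
    rw [add_zero] at h1
    exact le_of_tendsto_of_tendsto' (hy.dist tendsto_const_nhds) (h1.comp hψ.tendsto_atTop)
      fun n => hφd (ψ n)

end limitSet

/-! ### The orbit of the digit point -/

/-- `digitTail c p` as a point of the unit interval. -/
noncomputable def digitPoint {c : ℕ → ℕ} (hc : ∀ n, c n = 0 ∨ c n = 2) (p : ℕ) : unitInterval :=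
  ⟨digitTail c p, digitTail_nonneg p, (digitTail_le_half hc p).trans (by norm_num)⟩

/-- A leading digit 0 selects the lap `5 * x`, a leading 2 the lap `5 * x - 2`. The cut-off plays no
role, so `t` is arbitrary here and may later be the digit point itself. -/
theorem foldReal_digitTail {c : ℕ → ℕ} (hc : ∀ n, c n = 0 ∨ c n = 2) (t : ℝ) (p : ℕ) :
    foldReal t (digitTail c p) = digitTail c (p + 1) := by
  have h := digitTail_eq hc p
  have h0 := digitTail_nonneg (c := c) (p + 1)
  have h1 := digitTail_le_half hc (p + 1)
  unfold foldReal
  rcases hc p with hp | hp <;> rw [hp] at h <;> push_cast at h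
  · rw [h, min_eq_left (le_max_of_le_left (by linarith))]
    ring
  · rw [min_eq_left (b := max t _) (le_max_of_le_right (by linarith)), max_eq_right (by linarith),
      min_eq_right (by linarith)]
    linarith

theorem foldMap_iterate_digitPoint {c : ℕ → ℕ} (hc : ∀ n, c n = 0 ∨ c n = 2) (t : unitInterval)
    (p n : ℕ) : (foldMap t)^[n] (digitPoint hc p) = digitPoint hc (p + n) := by
  induction n with
  | zero => rfl
  | succ n ih =>
    rw [Function.iterate_succ_apply', ih]
    exact Subtype.ext (foldReal_digitTail hc _ _)

theorem limitSet_digitPoint {c : ℕ → ℕ} (hc : ∀ n, c n = 0 ∨ c n = 2) (t : unitInterval) :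
    limitSet (foldMap t) (digitPoint hc 0) = {y | MapClusterPt y atTop (digitPoint hc)} := by
  unfold limitSet
  simp only [foldMap_iterate_digitPoint hc, zero_add]

/-! ### Codes of ideal balls of the unit interval -/

/-- Numerator of the `n`-th ideal point of the unit interval. -/
def pointNum (n : ℕ) : ℕ := min n.unpair.1 (n.unpair.2 + 1)

/-- Denominator of the `n`-th ideal point of the unit interval. -/
def pointDen (n : ℕ) : ℕ := n.unpair.2 + 1

/-- Numerator of the `n`-th positive rational. -/
def radiusNum (n : ℕ) : ℕ := n.unpair.1 + 1

theorem pointDen_pos (n : ℕ) : 0 < pointDen n := Nat.succ_pos _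

theorem coe_unitPoint (n : ℕ) : (unitPoint n : ℝ) = pointNum n / pointDen n := rfl

theorem coe_posRatOfNat (n : ℕ) : ((posRatOfNat n : ℚ) : ℝ) = radiusNum n / pointDen n := by
  simp [posRatOfNat, radiusNum, pointDen]

theorem primrec_pointNum : Primrec pointNum :=
  Primrec.nat_min.comp (Primrec.fst.comp Primrec.unpair)
    (Primrec.succ.comp (Primrec.snd.comp Primrec.unpair))

theorem primrec_pointDen : Primrec pointDen :=
  Primrec.succ.comp (Primrec.snd.comp Primrec.unpair)

theorem primrec_radiusNum : Primrec radiusNum :=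
  Primrec.succ.comp (Primrec.fst.comp Primrec.unpair)

theorem mem_idealBall_unitInterval (i : ℕ) (x : unitInterval) : x ∈ idealBall unitInterval i ↔
    |(x : ℝ) - unitPoint i.unpair.1| < ((posRatOfNat i.unpair.2 : ℚ) : ℝ) := Iff.rfl

theorem exists_unitPoint_near (x : unitInterval) {ε : ℝ} (hε : 0 < ε) :
    ∃ n, |(x : ℝ) - unitPoint n| < ε := by
  obtain ⟨y, ⟨n, rfl⟩, hn⟩ := Metric.mem_closure_iff.1 (denseRange_unitPoint x) ε hε
  exact ⟨n, hn⟩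

theorem exists_posRatOfNat_eq (n : ℕ) : ∃ k, ((posRatOfNat k : ℚ) : ℝ) = 1 / ((n : ℝ) + 1) :=
  ⟨Nat.pair 0 n, by simp [posRatOfNat]⟩

/-! ### The map is computable -/

/-- The map `foldReal` on multiples of `1 / d`, with truncated subtraction. -/
def foldNat (d t x : ℕ) : ℕ :=
  min (5 * x) (max (2 * d - 5 * x) (min (5 * x - 2 * d) (max t (4 * d - 5 * x))))

theorem coe_foldNat {d t x : ℕ} (hd : 0 < d) :
    (foldNat d t x : ℝ) = d * foldReal (t / d) (x / d) := by
  have hd' : (0 : ℝ) < d := by exact_mod_cast hd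
  have hx : (d : ℝ) * (x / d) = x := mul_div_cancel₀ _ hd'.ne'
  have ht : (d : ℝ) * (t / d) = t := mul_div_cancel₀ _ hd'.ne'
  -- Truncation is harmless: whenever a difference is negative, the enclosing `max` is decided by a
  -- nonnegative competitor.
  have hint : (foldNat d t x : ℤ) =
      min (5 * (x : ℤ)) (max (2 * d - 5 * x) (min (5 * x - 2 * d) (max t (4 * d - 5 * x)))) := by
    unfold foldNat
    omega
  have hreal : (foldNat d t x : ℝ) =
      min (5 * (x : ℝ)) (max (2 * d - 5 * x) (min (5 * x - 2 * d) (max t (4 * d - 5 * x)))) := by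
    exact_mod_cast congrArg (Int.cast (R := ℝ)) hint
  rw [hreal]
  unfold foldReal
  simp only [mul_min_of_nonneg _ _ hd'.le, mul_max_of_nonneg _ _ hd'.le, mul_sub,
    mul_left_comm (d : ℝ) 5, hx, ht]
  simp only [mul_comm (d : ℝ)]

theorem primrec_foldNat {α : Type*} [Primcodable α] {d t x : α → ℕ} (hd : Primrec d)
    (ht : Primrec t) (hx : Primrec x) : Primrec fun a => foldNat (d a) (t a) (x a) := by
  have h5 := Primrec.nat_mul.comp (Primrec.const 5) hx
  have h2 := Primrec.nat_mul.comp (Primrec.const 2) hd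
  have h4 := Primrec.nat_mul.comp (Primrec.const 4) hd
  exact Primrec.nat_min.comp h5 (Primrec.nat_max.comp (Primrec.nat_sub.comp h2 h5)
    (Primrec.nat_min.comp (Primrec.nat_sub.comp h5 h2)
      (Primrec.nat_max.comp ht (Primrec.nat_sub.comp h4 h5))))

/-- The integer form of `|foldReal (w / e) (p / q) - p' / q'| + 5 * (u / v) + 1 / e < u' / v'`. -/
def FoldsInto (w e p q u v p' q' u' v' : ℕ) : Prop :=
  foldNat (q * v * q' * v' * e) (w * (q * v * q' * v')) (p * (v * q' * v' * e)) +
      (5 * (u * (q * q' * v' * e)) + q * v * q' * v') <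
    p' * (q * v * v' * e) + u' * (q * v * q' * e) ∧
  p' * (q * v * v' * e) + (5 * (u * (q * q' * v' * e)) + q * v * q' * v') <
    foldNat (q * v * q' * v' * e) (w * (q * v * q' * v')) (p * (v * q' * v' * e)) +
      u' * (q * v * q' * e)

theorem foldsInto_iff {w e p q u v p' q' u' v' : ℕ} (he : 0 < e) (hq : 0 < q) (hv : 0 < v)
    (hq' : 0 < q') (hv' : 0 < v') : FoldsInto w e p q u v p' q' u' v' ↔
      |foldReal (w / e) (p / q) - p' / q'| + (5 * (u / v) + 1 / e) < (u' / v' : ℝ) := by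
  have hd : 0 < q * v * q' * v' * e := by positivity
  have he0 : (0 : ℝ) < e := by exact_mod_cast he
  have hq0 : (0 : ℝ) < q := by exact_mod_cast hq
  have hv0 : (0 : ℝ) < v := by exact_mod_cast hv
  have hq0' : (0 : ℝ) < q' := by exact_mod_cast hq'
  have hv0' : (0 : ℝ) < v' := by exact_mod_cast hv'
  have hD : (0 : ℝ) < q * v * q' * v' * e := by positivity
  have h1 : ((w * (q * v * q' * v') : ℕ) : ℝ) / (q * v * q' * v' * e : ℕ) = w / e := by
    push_cast; field_simp
  have h2 : ((p * (v * q' * v' * e) : ℕ) : ℝ) / (q * v * q' * v' * e : ℕ) = p / q := by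
    push_cast; field_simp
  have hF := coe_foldNat (t := w * (q * v * q' * v')) (x := p * (v * q' * v' * e)) hd
  rw [h1, h2] at hF
  unfold FoldsInto
  generalize foldNat (q * v * q' * v' * e) (w * (q * v * q' * v')) (p * (v * q' * v' * e)) = F at *
  generalize foldReal (w / e) (p / q) = y at *
  rw [← @Nat.cast_lt ℝ, ← @Nat.cast_lt ℝ, ← lt_sub_iff_add_lt, abs_lt]
  push_cast at hF ⊢
  rw [hF]
  have e1 : (u : ℝ) * (q * q' * v' * e) = q * v * q' * v' * e * (u / v) := by field_simp
  have e2 : (q * v * q' * v' : ℝ) = q * v * q' * v' * e * (1 / e) := by field_simp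
  have e3 : (p' : ℝ) * (q * v * v' * e) = q * v * q' * v' * e * (p' / q') := by field_simp
  have e4 : (u' : ℝ) * (q * v * q' * e) = q * v * q' * v' * e * (u' / v') := by field_simp
  rw [e1, e3, e4]
  set D : ℝ := q * v * q' * v' * e
  rw [e2]
  rw [mul_left_comm 5 D, ← mul_add, ← mul_add, ← mul_add, ← mul_add, ← mul_add,
    mul_lt_mul_iff_right₀ hD, mul_lt_mul_iff_right₀ hD, and_comm]
  constructor <;> rintro ⟨h, h'⟩ <;> constructor <;> linarith

theorem primrecPred_foldsInto {α : Type*} [Primcodable α] {w e p q u v p' q' u' v' : α → ℕ}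
    (hw : Primrec w) (he : Primrec e) (hp : Primrec p) (hq : Primrec q) (hu : Primrec u)
    (hv : Primrec v) (hp' : Primrec p') (hq' : Primrec q') (hu' : Primrec u')
    (hv' : Primrec v') : PrimrecPred fun a =>
      FoldsInto (w a) (e a) (p a) (q a) (u a) (v a) (p' a) (q' a) (u' a) (v' a) := by
  have mul : ∀ {f g : α → ℕ}, Primrec f → Primrec g → Primrec fun a => f a * g a :=
    fun hf hg => Primrec.nat_mul.comp hf hg
  have add : ∀ {f g : α → ℕ}, Primrec f → Primrec g → Primrec fun a => f a + g a :=
    fun hf hg => Primrec.nat_add.comp hf hg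
  have hk := mul (mul (mul hq hv) hq') hv'
  have hF := primrec_foldNat (mul hk he) (mul hw hk) (mul hp (mul (mul (mul hv hq') hv') he))
  have hE := add (mul (Primrec.const 5) (mul hu (mul (mul (mul hq hq') hv') he))) hk
  have hC := mul hp' (mul (mul (mul hq hv) hv') he)
  have hR := mul hu' (mul (mul (mul hq hv) hq') he)
  exact (Primrec.nat_lt.comp (add hF hE) (add hC hR)).and
    (Primrec.nat_lt.comp (add hC hE) (add hF hR))

theorem primrec_five_pow : Primrec fun n : ℕ => 5 ^ n :=
  (Primrec.nat_rec₁ (f := fun _ r => r * 5) 1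
    (Primrec.nat_mul.comp Primrec.snd (Primrec.const 5))).of_eq fun n => by
      induction n with
      | zero => rfl
      | succ n ih => rw [pow_succ, ← ih]

theorem REPred.exists_nat {α : Type*} [Primcodable α] {p : α → ℕ → Prop} (hp : PrimrecRel p) :
    REPred fun a => ∃ n, p a n := by
  obtain ⟨hdec, h⟩ := hp
  have h' : Computable₂ (fun (a : α) (n : ℕ) => @decide (p a n) (hdec (a, n))) := h.to_comp
  refine (Partrec.rfind h'.partrec₂).dom_re.of_eq fun a => ?_
  refine Nat.rfind_dom.trans ?_
  simp

/-- The ball `i` is seen to be mapped into the ball `m` when the cut-off height is known with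
precision `5⁻ⁿ`. -/
def BallFoldsInto (c : ℕ → ℕ) (m i n : ℕ) : Prop :=
  FoldsInto (digitWord c 0 n) (5 ^ n) (pointNum i.unpair.1) (pointDen i.unpair.1)
    (radiusNum i.unpair.2) (pointDen i.unpair.2) (pointNum m.unpair.1) (pointDen m.unpair.1)
    (radiusNum m.unpair.2) (pointDen m.unpair.2)

theorem ballFoldsInto_iff (c : ℕ → ℕ) (m i n : ℕ) : BallFoldsInto c m i n ↔
    |foldReal (digitWord c 0 n / 5 ^ n) (unitPoint i.unpair.1) - unitPoint m.unpair.1| +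
      (5 * ((posRatOfNat i.unpair.2 : ℚ) : ℝ) + 1 / 5 ^ n) <
        ((posRatOfNat m.unpair.2 : ℚ) : ℝ) := by
  unfold BallFoldsInto
  rw [foldsInto_iff (by positivity) (pointDen_pos _) (pointDen_pos _) (pointDen_pos _)
    (pointDen_pos _), coe_unitPoint, coe_unitPoint, coe_posRatOfNat, coe_posRatOfNat]
  push_cast
  rfl

theorem primrecRel_ballFoldsInto {c : ℕ → ℕ} (hc : Primrec c) :
    PrimrecRel fun (a : ℕ × ℕ) (n : ℕ) => BallFoldsInto c a.1 a.2 n := by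
  have hm : Primrec fun a : (ℕ × ℕ) × ℕ => a.1.1.unpair :=
    Primrec.unpair.comp (Primrec.fst.comp Primrec.fst)
  have hi : Primrec fun a : (ℕ × ℕ) × ℕ => a.1.2.unpair :=
    Primrec.unpair.comp (Primrec.snd.comp Primrec.fst)
  have hm1 := Primrec.fst.comp hm
  have hm2 := Primrec.snd.comp hm
  have hi1 := Primrec.fst.comp hi
  have hi2 := Primrec.snd.comp hi
  exact primrecPred_foldsInto ((primrec_digitWord hc).comp (Primrec.const 0) Primrec.snd)
    (primrec_five_pow.comp Primrec.snd) (primrec_pointNum.comp hi1) (primrec_pointDen.comp hi1)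
    (primrec_radiusNum.comp hi2) (primrec_pointDen.comp hi2) (primrec_pointNum.comp hm1)
    (primrec_pointDen.comp hm1) (primrec_radiusNum.comp hm2) (primrec_pointDen.comp hm2)

theorem exists_one_div_five_pow_lt {ε : ℝ} (hε : 0 < ε) : ∃ n : ℕ, 1 / (5 : ℝ) ^ n < ε := by
  obtain ⟨n, hn⟩ := exists_pow_lt_of_lt_one hε (show (1 / 5 : ℝ) < 1 by norm_num)
  exact ⟨n, by rwa [one_div_pow] at hn⟩

theorem isComputableMap_foldMap {c : ℕ → ℕ} (hc : ∀ n, c n = 0 ∨ c n = 2) (hcp : Primrec c) :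
    IsComputableMap (foldMap (digitPoint hc 0)) := by
  have hW : REPred fun a : ℕ × ℕ => ∃ n, BallFoldsInto c a.1 a.2 n :=
    REPred.exists_nat (primrecRel_ballFoldsInto hcp)
  refine ⟨_, hW, fun m => ?_⟩
  -- The term `5 * r` is the effect of moving the point, `1 / 5 ^ n` that of truncating the cut-off
  -- height.
  have happrox : ∀ (n i : ℕ) (x : unitInterval) (r : ℝ), |(x : ℝ) - unitPoint i| ≤ r →
      |(foldMap (digitPoint hc 0) x : ℝ) - foldReal (digitWord c 0 n / 5 ^ n) (unitPoint i)| ≤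
        5 * r + 1 / 5 ^ n := by
    intro n i x r hr
    have h5 : (0 : ℝ) < 1 / 5 ^ n := by positivity
    have hr0 := (abs_nonneg _).trans hr
    refine (abs_foldReal_sub_le _ _ _ _).trans (max_le ?_ ?_)
    · exact (abs_digitTail_sub_le hc 0 n).trans (by linarith)
    · linarith
  ext x
  simp only [Set.mem_preimage, mem_idealBall_unitInterval, Set.mem_iUnion, Set.mem_ofPred_eq,
    exists_prop, ballFoldsInto_iff]
  constructor
  · intro hx
    -- The error of `happrox` is paid twice, once in the approximation and once in the test. The
    -- total is below `12 / (N + 1)`, so a twentieth of the gap is ample.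
    obtain ⟨N, hN⟩ := exists_nat_one_div_lt (show 0 < (((posRatOfNat m.unpair.2 : ℚ) : ℝ) -
      |(foldMap (digitPoint hc 0) x : ℝ) - unitPoint m.unpair.1|) / 20 by linarith)
    obtain ⟨n, hn⟩ := exists_one_div_five_pow_lt (show 0 < 1 / ((N : ℝ) + 1) by positivity)
    obtain ⟨k, hk⟩ := exists_posRatOfNat_eq N
    obtain ⟨j, hj⟩ := exists_unitPoint_near x (show 0 < 1 / ((N : ℝ) + 1) by positivity)
    refine ⟨Nat.pair j k, ⟨n, ?_⟩, ?_⟩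
    · simp only [Nat.unpair_pair]
      have h1 := happrox n j x _ hj.le
      rw [abs_sub_comm] at h1
      have h2 := abs_sub_le (foldReal (digitWord c 0 n / 5 ^ n) (unitPoint j))
        (foldMap (digitPoint hc 0) x) (unitPoint m.unpair.1)
      rw [hk]
      linarith
    · simpa only [Nat.unpair_pair, hk] using hj
  · rintro ⟨i, ⟨n, hn⟩, hi⟩
    have h1 := happrox n _ x _ hi.le
    have h2 := abs_sub_le (foldMap (digitPoint hc 0) x : ℝ)
      (foldReal (digitWord c 0 n / 5 ^ n) (unitPoint i.unpair.1)) (unitPoint m.unpair.1)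
    linarith

/-! ### The outer collection of the attractor -/

/-- The integer form of `u / v + 2 / e < |w / e - p / q|`. -/
def FarFrom (w e p q u v : ℕ) : Prop :=
  p * (e * v) + (u * (e * q) + 2 * (q * v)) < w * (q * v) ∨
    w * (q * v) + (u * (e * q) + 2 * (q * v)) < p * (e * v)

instance (w e p q u v : ℕ) : Decidable (FarFrom w e p q u v) :=
  inferInstanceAs (Decidable (_ ∨ _))

theorem farFrom_iff {w e p q u v : ℕ} (he : 0 < e) (hq : 0 < q) (hv : 0 < v) :
    FarFrom w e p q u v ↔ (u / v + 2 / e : ℝ) < |(w / e - p / q : ℝ)| := by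
  have he0 : (0 : ℝ) < e := by exact_mod_cast he
  have hq0 : (0 : ℝ) < q := by exact_mod_cast hq
  have hv0 : (0 : ℝ) < v := by exact_mod_cast hv
  have hD : (0 : ℝ) < e * q * v := by positivity
  unfold FarFrom
  rw [← @Nat.cast_lt ℝ, ← @Nat.cast_lt ℝ, lt_abs]
  push_cast
  have e1 : (p : ℝ) * (e * v) = e * q * v * (p / q) := by field_simp
  have e2 : (u : ℝ) * (e * q) = e * q * v * (u / v) := by field_simp
  have e3 : (2 : ℝ) * (q * v) = e * q * v * (2 / e) := by field_simp
  have e4 : (w : ℝ) * (q * v) = e * q * v * (w / e) := by field_simp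
  rw [e1, e2, e3, e4, ← mul_add, ← mul_add, ← mul_add, mul_lt_mul_iff_right₀ hD,
    mul_lt_mul_iff_right₀ hD]
  refine or_congr ?_ ?_ <;> constructor <;> intro h <;> linarith

/-- From time `n` on, the orbit is seen with precision `5⁻ᴺ` to be away from the ball `i`. -/
def OrbitFarFrom (c : ℕ → ℕ) (i N n : ℕ) : Prop :=
  n < N ∨ FarFrom (digitWord c n N) (5 ^ N) (pointNum i.unpair.1) (pointDen i.unpair.1)
    (radiusNum i.unpair.2) (pointDen i.unpair.2)

theorem orbitFarFrom_iff (c : ℕ → ℕ) (i N n : ℕ) : OrbitFarFrom c i N n ↔ n < N ∨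
    ((posRatOfNat i.unpair.2 : ℚ) : ℝ) + 2 / 5 ^ N <
      |(digitWord c n N : ℝ) / 5 ^ N - unitPoint i.unpair.1| := by
  unfold OrbitFarFrom
  rw [farFrom_iff (by positivity) (pointDen_pos _) (pointDen_pos _), coe_unitPoint,
    coe_posRatOfNat]
  push_cast
  rfl

theorem primrecPred_orbitFarFrom {c : ℕ → ℕ} (hc : Primrec c) :
    PrimrecPred fun a : ℕ × ℕ × ℕ => OrbitFarFrom c a.1 a.2.1 a.2.2 := by
  have mul : ∀ {f g : ℕ × ℕ × ℕ → ℕ}, Primrec f → Primrec g → Primrec fun a => f a * g a :=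
    fun hf hg => Primrec.nat_mul.comp hf hg
  have add : ∀ {f g : ℕ × ℕ × ℕ → ℕ}, Primrec f → Primrec g → Primrec fun a => f a + g a :=
    fun hf hg => Primrec.nat_add.comp hf hg
  have hi : Primrec fun a : ℕ × ℕ × ℕ => a.1.unpair := Primrec.unpair.comp Primrec.fst
  have hN : Primrec fun a : ℕ × ℕ × ℕ => a.2.1 := Primrec.fst.comp Primrec.snd
  have hn : Primrec fun a : ℕ × ℕ × ℕ => a.2.2 := Primrec.snd.comp Primrec.snd
  have hw := (primrec_digitWord hc).comp hn hN
  have he := primrec_five_pow.comp hN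
  have hp := primrec_pointNum.comp (Primrec.fst.comp hi)
  have hq := primrec_pointDen.comp (Primrec.fst.comp hi)
  have hu := primrec_radiusNum.comp (Primrec.snd.comp hi)
  have hv := primrec_pointDen.comp (Primrec.snd.comp hi)
  have hR := add (mul hu (mul he hq)) (mul (Primrec.const 2) (mul hq hv))
  have hC := mul hp (mul he hv)
  have hW := mul hw (mul hq hv)
  exact (Primrec.nat_lt.comp hn hN).or
    ((Primrec.nat_lt.comp (add hC hR) hW).or (Primrec.nat_lt.comp (add hW hR) hC))

theorem mem_outerCollection_limitSet_iff {c : ℕ → ℕ} (hc : ∀ n, c n = 0 ∨ c n = 2)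
    (t : unitInterval) (i : ℕ) :
    i ∈ outerCollection (limitSet (foldMap t) (digitPoint hc 0)) ↔
      ∀ y, MapClusterPt y atTop (digitPoint hc) →
        ((posRatOfNat i.unpair.2 : ℚ) : ℝ) < dist y (unitPoint i.unpair.1) := by
  change Disjoint _ _ ↔ _
  rw [limitSet_digitPoint, Set.disjoint_right]
  exact forall₂_congr fun y _ => not_le (a := dist y (unitPoint i.unpair.1))

/-- By compactness, the closed ball misses the limit set iff the orbit eventually keeps a positive
margin from it. One number `N` serves as both starting time and precision, leaving the form `∃ N, ∀
n`. -/
theorem isSigmaTwo_outerCollection {c : ℕ → ℕ} (hc : ∀ n, c n = 0 ∨ c n = 2) (hcp : Primrec c)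
    (t : unitInterval) :
    IsSigmaTwo (outerCollection (limitSet (foldMap t) (digitPoint hc 0))) := by
  obtain ⟨_, hprim⟩ := primrecPred_orbitFarFrom hcp
  refine ⟨_, hprim.to_comp, fun i => ?_⟩
  simp only [decide_eq_true_eq]
  rw [mem_outerCollection_limitSet_iff]
  set r : ℝ := ((posRatOfNat i.unpair.2 : ℚ) : ℝ)
  set z := unitPoint i.unpair.1
  have hdist : ∀ n N : ℕ, abs (dist (digitPoint hc n) z - |(digitWord c n N : ℝ) / 5 ^ N - z|) ≤
      1 / 5 ^ N := fun n N => by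
    refine (abs_abs_sub_abs_le _ _).trans ?_
    rw [sub_sub_sub_cancel_right]
    exact abs_digitTail_sub_le hc n N
  constructor
  · intro h
    by_contra! hne
    simp only [orbitFarFrom_iff, not_or, not_lt] at hne
    have hfreq : ∀ ε > 0, ∃ᶠ n in atTop, dist (digitPoint hc n) z ≤ r + ε := by
      intro ε hε
      rw [frequently_atTop]
      intro M
      -- The failed test costs `2 / 5 ^ N` and the approximation `1 / 5 ^ N`, whence the division by
      -- 3.
      obtain ⟨K, hK⟩ := exists_one_div_five_pow_lt (show 0 < ε / 3 by linarith)
      obtain ⟨n, hn1, hn2⟩ := hne (max M K)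
      refine ⟨n, (le_max_left _ _).trans hn1, ?_⟩
      have h1 := (abs_le.1 (hdist n (max M K))).2
      have h2 : 1 / (5 : ℝ) ^ (max M K) ≤ 1 / 5 ^ K :=
        one_div_le_one_div_of_le (by positivity)
          (pow_le_pow_right₀ (by norm_num) (le_max_right _ _))
      have h3 : 2 / (5 : ℝ) ^ (max M K) = 2 * (1 / 5 ^ (max M K)) := by ring
      linarith
    obtain ⟨y, hy, hyz⟩ := exists_mapClusterPt_dist_le hfreq
    exact absurd (h y hy) (not_lt.2 hyz)
  · rintro ⟨N, hN⟩ y hy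
    have h5 : (0 : ℝ) < 1 / 5 ^ N := by positivity
    -- Of the tested margin `2 / 5 ^ N` one half absorbs the approximation error. The other half
    -- survives the limit and keeps the inequality strict.
    have := le_dist_of_mapClusterPt (z := z) (r := r + 1 / 5 ^ N) hy
      (eventually_atTop.2 ⟨N, fun n hn => ?_⟩)
    · linarith
    · have h1 := ((orbitFarFrom_iff c i N n).1 (hN n)).resolve_left (not_lt.2 hn)
      have h2 := (abs_le.1 (hdist n N)).1
      have h3 : 2 / (5 : ℝ) ^ N = 2 * (1 / 5 ^ N) := by ring
      linarith

/-- The ball whose points on the orbit are those with an expansion starting with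
`2 0^k 2`. -/
def wordBall (k : ℕ) : ℕ :=
  Nat.pair (Nat.pair (2 * 5 ^ (k + 1) + 2) (5 ^ (k + 2) - 1)) (Nat.pair 0 (5 ^ (k + 2) - 1))

theorem primrec_wordBall : Primrec wordBall := by
  have h1 := primrec_five_pow.comp Primrec.succ
  have h2 := Primrec.pred.comp (primrec_five_pow.comp (Primrec.succ.comp Primrec.succ))
  exact Primrec₂.natPair.comp (Primrec₂.natPair.comp
    (Primrec.nat_add.comp (Primrec.nat_mul.comp (Primrec.const 2) h1) (Primrec.const 2)) h2)
    (Primrec₂.natPair.comp (Primrec.const 0) h2)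

theorem wordBall_radius (k : ℕ) :
    ((posRatOfNat (wordBall k).unpair.2 : ℚ) : ℝ) = 1 / 5 ^ (k + 2) := by
  have h : 5 ^ (k + 2) - 1 + 1 = 5 ^ (k + 2) := Nat.sub_add_cancel (Nat.one_le_pow _ _ (by norm_num))
  rw [coe_posRatOfNat]
  simp only [wordBall, Nat.unpair_pair, radiusNum, pointDen, h]
  push_cast
  ring

theorem wordBall_center (k : ℕ) : (unitPoint (wordBall k).unpair.1 : ℝ) =
    (2 * 5 ^ (k + 1) + 2 : ℕ) / 5 ^ (k + 2) := by
  have h : 5 ^ (k + 2) - 1 + 1 = 5 ^ (k + 2) := Nat.sub_add_cancel (Nat.one_le_pow _ _ (by norm_num))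
  have h1 : 1 ≤ 5 ^ k := (Nat.one_le_pow _ _ (by norm_num))
  -- This ensures that the `min` in `pointNum` does not alter the intended centre.
  have hle : 2 * 5 ^ (k + 1) + 2 ≤ 5 ^ (k + 2) := by
    rw [pow_succ, pow_succ]
    omega
  rw [coe_unitPoint]
  simp only [wordBall, Nat.unpair_pair, pointNum, pointDen, h, min_eq_left hle]
  push_cast
  rfl

theorem dist_wordBall_le {c : ℕ → ℕ} (hc : ∀ n, c n = 0 ∨ c n = 2) {p k : ℕ}
    (h : digitWord c p (k + 2) = 2 * 5 ^ (k + 1) + 2) :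
    dist (digitPoint hc p) (unitPoint (wordBall k).unpair.1) ≤ 1 / 5 ^ (k + 2) := by
  change |digitTail c p - (unitPoint (wordBall k).unpair.1 : ℝ)| ≤ _
  rw [wordBall_center, ← h]
  exact abs_digitTail_sub_le hc p (k + 2)

/-- In units of `1 / 5 ^ (k + 2)`, a different word is at least 2 away and the remaining tail
recovers at most `1/2`. Since `3/2` exceeds the radius 1, limits of such points also stay outside
the closed ball. -/
theorem le_dist_wordBall {c : ℕ → ℕ} (hc : ∀ n, c n = 0 ∨ c n = 2) {p k : ℕ}
    (h : digitWord c p (k + 2) ≠ 2 * 5 ^ (k + 1) + 2) :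
    3 / 2 * (1 / 5 ^ (k + 2)) ≤ dist (digitPoint hc p) (unitPoint (wordBall k).unpair.1) := by
  change _ ≤ |digitTail c p - (unitPoint (wordBall k).unpair.1 : ℝ)|
  have h5 : (0 : ℝ) < 5 ^ (k + 2) := by positivity
  have hexp := digitTail_eq_digitWord_add hc p (k + 2)
  have h0 := digitTail_nonneg (c := c) (p + (k + 2))
  have h1 := digitTail_le_half hc (p + (k + 2))
  obtain ⟨w, hw⟩ := even_digitWord hc p (k + 2)
  obtain ⟨b, hb⟩ : Even (2 * 5 ^ (k + 1) + 2) := ⟨5 ^ (k + 1) + 1, by ring⟩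
  rw [wordBall_center, hb]
  rw [hw] at hexp
  rw [hw, hb] at h
  have hsub : digitTail c p - (b + b : ℕ) / 5 ^ (k + 2) =
      ((w + w : ℕ) + digitTail c (p + (k + 2)) - (b + b : ℕ)) / 5 ^ (k + 2) := by
    rw [← hexp]
    field_simp
  rw [hsub, abs_div, abs_of_pos h5, ← mul_div_assoc, mul_one]
  gcongr
  push_cast
  rcases lt_or_gt_of_ne (show w ≠ b by rintro rfl; exact h rfl) with hlt | hlt
  · have : (w : ℝ) + 1 ≤ b := by exact_mod_cast hlt
    exact le_abs.2 (.inr (by linarith))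
  · have : (b : ℝ) + 1 ≤ w := by exact_mod_cast hlt
    exact le_abs.2 (.inl (by linarith))

theorem wordBall_mem_outerCollection_iff {c : ℕ → ℕ} (hc : ∀ n, c n = 0 ∨ c n = 2)
    (t : unitInterval) (k : ℕ) :
    wordBall k ∈ outerCollection (limitSet (foldMap t) (digitPoint hc 0)) ↔
      {p | digitWord c p (k + 2) = 2 * 5 ^ (k + 1) + 2}.Finite := by
  rw [mem_outerCollection_limitSet_iff, wordBall_radius]
  have h5 : (0 : ℝ) < 1 / 5 ^ (k + 2) := by positivity
  constructor
  · intro h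
    by_contra hinf
    obtain ⟨y, hy, hyz⟩ := exists_mapClusterPt_dist_le (u := digitPoint hc)
      (z := unitPoint (wordBall k).unpair.1) (r := 1 / 5 ^ (k + 2)) fun ε hε =>
        (Nat.frequently_atTop_iff_infinite.2 hinf).mono fun p hp =>
          (dist_wordBall_le hc hp).trans (by linarith)
    exact absurd (h y hy) (not_lt.2 hyz)
  · intro hfin y hy
    have hev : ∀ᶠ p in atTop, digitWord c p (k + 2) ≠ 2 * 5 ^ (k + 1) + 2 := by
      rw [← Nat.cofinite_eq_atTop]
      exact hfin.compl_mem_cofinite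
    have := le_dist_of_mapClusterPt hy (hev.mono fun p hp => le_dist_wordBall hc hp)
    linarith

/-! ### Completeness -/

theorem EnumReducible.of_manyOneReducible {A B : Set ℕ}
    (h : ManyOneReducible (fun n => n ∈ A) (fun n => n ∈ B)) : EnumReducible A B := by
  obtain ⟨g, hg, hgAB⟩ := h
  refine ⟨fun p => p.2 = [g p.1], ?_, fun n => ?_⟩
  · refine ComputablePred.to_re (Computable.computablePred ?_)
    have hl : Computable fun p : ℕ × List ℕ => [g p.1] :=
      Computable.list_cons.comp (hg.comp Computable.fst) (Computable.const [])
    exact (Primrec.beq (α := List ℕ)).to_comp.comp Computable.snd hl |>.of_eq fun p => by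
      simp [beq_eq_decide]
  · simp [hgAB n]

theorem isSigmaTwoCompleteSet_outerCollection
    (hc : ∀ n, blockDigit haltingSeq n = 0 ∨ blockDigit haltingSeq n = 2) (t : unitInterval) :
    IsSigmaTwoCompleteSet (outerCollection (limitSet (foldMap t) (digitPoint hc 0))) := by
  refine ⟨isSigmaTwo_outerCollection hc (primrec_blockDigit primrec_haltingSeq) t,
    fun S hS => ?_⟩
  obtain ⟨g, hg, hgS⟩ := hS.exists_finite_dom
  -- The shift by 1 is that of `haltingSeq`, where 0 is the filler value.
  refine ⟨fun i => wordBall (g i + 1), (primrec_wordBall.comp Primrec.succ).to_comp.comp hg,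
    fun i => ?_⟩
  change i ∈ S ↔ wordBall (g i + 1) ∈ _
  rw [wordBall_mem_outerCollection_iff, hgS, ← not_iff_not]
  exact (infinite_haltingSeq_eq_succ_iff (g i)).symm.trans
    (infinite_digitWord_eq_iff haltingSeq (g i + 1)).symm

theorem mainTheorem8 :
    ∃ (f : unitInterval → unitInterval) (A : Set unitInterval),
      IsComputableMap f ∧
      IsMetricAttractor (MeasureTheory.volume : MeasureTheory.Measure unitInterval) f A ∧
      IsPiTwoComplete A ∧
      IsSigmaTwoCompleteSet (outerCollection A) := by
  have hc := blockDigit_eq_zero_or_two haltingSeq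
  have hcomplete := isSigmaTwoCompleteSet_outerCollection hc (digitPoint hc 0)
  exact ⟨foldMap (digitPoint hc 0), limitSet (foldMap (digitPoint hc 0)) (digitPoint hc 0),
    isComputableMap_foldMap hc (primrec_blockDigit primrec_haltingSeq),
    isMetricAttractor_limitSet (continuous_foldMap _) (volume_setOf_never_hit _),
    ⟨isClosed_limitSet _ _, hcomplete.1,
      -- Only the `Σ₂` set of ball numbers of the other closed set matters; the geometry of its
      -- ambient space does not enter.
      fun _ _ _ _ _ hK => .of_manyOneReducible (hcomplete.2 _ hK)⟩,
    hcomplete⟩
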